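/- Let $c>0$ and $d$ be coprime integers. Let $\mathrm{sign}(x)\in\{-1,0,1\}$ denote the sign of an integer $x$, and define the Hardy sums $$S(d,c)=\sum_{k=1}^{c-1}(-1)^{k+1+\lfloor dk/c\rfloor},\qquad S_4(d,c)=\sum_{k=1}^{c-1}(-1)^{\lfloor dk/c\rfloor}.$$ For integers $x_0,\dots,x_n$ write $$[x_0;x_1,\dots,x_n]=x_0+\cfrac{1}{x_1+\cfrac{1}{\cdots+\cfrac{1}{x_n}}},\qquad [\![x_0;x_1,\dots,x_n]\!]=x_0-\cfrac{1}{x_1-\cfrac{1}{\cdots-\cfrac{1}{x_n}}}.$$ (1) Suppose that $c+d$ is odd. Then $\frac dc$ can be written in exactly one way as $\frac dc=[\![2c_0;2c_1,\dots,2c_n]\!]$ with $n\ge 0$, $c_0\in\mathbf Z$ and non-zero integers $c_1,\dots,c_n$, and for this expansion $$S(d,c)=-\sum_{k=1}^n\mathrm{sign}(c_k).$$ (2) Suppose that $d$ is odd. Then $\frac dc$ can be written as $\frac dc=[2a_0;a_1,2a_2,a_3,\dots,2a_{n-1},a_n]$ with $n\ge 1$ odd, $a_0\in\mathbf Z$,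 and non-zero integers $a_1,\dots,a_n$ such that $|a_k|>1$ for $k=1,3,\dots,n-2$; and for every such expansion $$S_4(d,c)=(a_1+a_3+\cdots+a_n)+\sum_{k=1}^n(-1)^k\,\mathrm{sign}(a_k).$$ -/

import Mathlib

/-- `(-1) ^ m` as an integer, for an integer exponent `m` of either sign. -/
def minusOnePow (m : ℤ) : ℤ := (((-1 : ℤˣ) ^ m : ℤˣ) : ℤ)

/-- The Hardy sum `S(d, c) = ∑_{k = 1}^{c - 1} (-1) ^ (k + 1 + ⌊d k / c⌋)` (for `c > 0`). -/
noncomputable def hardyS (d c : ℤ) : ℤ :=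
  ∑ k ∈ Finset.Icc 1 (c - 1), minusOnePow (k + 1 + ⌊(d : ℚ) * (k : ℚ) / (c : ℚ)⌋)

/-- The Hardy sum `S₄(d, c) = ∑_{k = 1}^{c - 1} (-1) ^ ⌊d k / c⌋` (for `c > 0`). -/
noncomputable def hardyS4 (d c : ℤ) : ℤ :=
  ∑ k ∈ Finset.Icc 1 (c - 1), minusOnePow ⌊(d : ℚ) * (k : ℚ) / (c : ℚ)⌋

/-- The continued fraction `[a 0; a 1, …, a n] = a 0 + 1 / (a 1 + 1 / (⋯ + 1 / a n))`. -/
def contFrac (a : ℕ → ℤ) : ℕ → ℚ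
  | 0 => (a 0 : ℚ)
  | n + 1 => (a 0 : ℚ) + 1 / contFrac (fun k => a (k + 1)) n

/-- The negative continued fraction
`⟦a 0; a 1, …, a n⟧ = a 0 - 1 / (a 1 - 1 / (⋯ - 1 / a n))`. -/
def negContFrac (a : ℕ → ℤ) : ℕ → ℚ
  | 0 => (a 0 : ℚ)
  | n + 1 => (a 0 : ℚ) - 1 / negContFrac (fun k => a (k + 1)) n

/-- `x = ⟦2 c 0; 2 c 1, …, 2 c n⟧` with `c 0` any integer and `c 1, …, c n` non-zero.
Only the values `c 0, …, c n` of the sequence `c` matter. The non-vanishing condition forces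
every denominator that occurs to have absolute value greater than `1`. -/
def IsThetaExpansion (x : ℚ) (n : ℕ) (c : ℕ → ℤ) : Prop :=
  (∀ k, 1 ≤ k → k ≤ n → c k ≠ 0) ∧ x = negContFrac (fun k => 2 * c k) n

/-- `x = [2 a 0; a 1, 2 a 2, a 3, …, 2 a (n - 1), a n]` with `n` odd, `a 0` any integer,
`a 1, …, a n` non-zero and `|a k| > 1` for `k = 1, 3, …, n - 2`.
Only the values `a 0, …, a n` of the sequence `a` matter. The conditions on the `a k` force
every denominator that occurs to have absolute value at least `1`. -/
def IsGammaTwoExpansion (x : ℚ) (n : ℕ) (a : ℕ → ℤ) : Prop :=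
  Odd n ∧ (∀ k, 1 ≤ k → k ≤ n → a k ≠ 0) ∧ (∀ k, Odd k → k < n → 1 < |a k|) ∧
    x = contFrac (fun k => if Even k then 2 * a k else a k) n

/-!
Both Hardy sums are studied as functions of the rational number `x = d / c`. The function `S` has
period `2`, is odd, and satisfies Hardy's reciprocity law `S(1 / x) + S(x) = sign x` whenever
numerator and denominator of `x` have opposite parity (`hardyS_reciprocity`, `ratS_inv`). Hence
`S(2 m - 1 / y) = S(y) - sign y`, and peeling off one partial quotient `2 c` of an even negative
continued fraction costs `-sign c`: the complete quotient `y` that starts with `2 c ≠ 0` lies at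
distance less than `1` from `2 c`, so it has the sign of `c` and `|y| > 1`. The same bound shows
that `2 c` is the only even integer at distance less than `1` from `y`, which yields uniqueness and,
read as an algorithm with decreasing denominators, existence.

The second sum is reduced to the first by `S₄(x) = -S(x + 1)`. In the variable `z = 1 / x`,
reciprocity becomes `S₄(1 / (z + 1)) = S₄(1 / z) + sign (1 + 1 / z)` (`ratS4_inv_add_one`). Adding
up unit steps gives `S₄(1 / (a + w)) = S₄(1 / w) + a - sign a + sign w` for `0 < |w| ≤ 1 < |a|`
(`ratS4_inv_intCast_add`), which is the contribution of two consecutive partial quotients `a` and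
`2 a'` in an expansion whose even places carry even integers. The condition `|a| > 1` keeps `a + w`
away from zero. Existence again follows by descent on the denominator, rounding to an even integer
at the even places and away from zero at the odd ones.
-/

/-! ### Hardy sums on rational numbers -/

lemma minusOnePow_add (m n : ℤ) : minusOnePow (m + n) = minusOnePow m * minusOnePow n := by
  simp [minusOnePow, zpow_add]

lemma minusOnePow_natCast (n : ℕ) : minusOnePow n = (-1) ^ n := by
  simp [minusOnePow]

lemma minusOnePow_neg (m : ℤ) : minusOnePow (-m) = minusOnePow m := by
  simp [minusOnePow]

lemma minusOnePow_one : minusOnePow 1 = -1 := by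
  simp [minusOnePow]

lemma minusOnePow_add_self (m : ℤ) : minusOnePow (m + m) = 1 := by
  rw [minusOnePow_add, minusOnePow, ← Units.val_mul, Int.units_mul_self, Units.val_one]

lemma floor_div_eq (d k : ℤ) (c : ℕ) :
    ⌊(d : ℚ) * (k : ℚ) / (((c : ℕ) : ℤ) : ℚ)⌋ = d * k / (c : ℤ) := by
  rw [← Int.cast_mul, Int.cast_natCast, Rat.floor_intCast_div_natCast]

/-- The Hardy sum `S` as a function of the fraction `d / c`, taken in lowest terms. -/
noncomputable def ratS (x : ℚ) : ℤ := hardyS x.num x.den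

/-- The Hardy sum `S₄` as a function of the fraction `d / c`, taken in lowest terms. -/
noncomputable def ratS4 (x : ℚ) : ℤ := hardyS4 x.num x.den

lemma hardyS_eq (d : ℤ) (c : ℕ) :
    hardyS d c = ∑ k ∈ Finset.Icc 1 ((c : ℤ) - 1), minusOnePow (k + 1 + d * k / (c : ℤ)) := by
  simp only [hardyS, floor_div_eq]

lemma hardyS4_eq (d : ℤ) (c : ℕ) :
    hardyS4 d c = ∑ k ∈ Finset.Icc 1 ((c : ℤ) - 1), minusOnePow (d * k / (c : ℤ)) := by
  simp only [hardyS4, floor_div_eq]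

lemma hardyS_add (d m : ℤ) {c : ℕ} (hc : 0 < c) :
    hardyS (d + 2 * m * c) c = hardyS d c := by
  rw [hardyS_eq, hardyS_eq]
  refine Finset.sum_congr rfl fun k _ => ?_
  have : (d + 2 * m * c) * k / (c : ℤ) = d * k / c + (m * k + m * k) := by
    rw [← Int.add_mul_ediv_right _ _ (by positivity)]
    ring_nf
  rw [this, ← add_assoc, minusOnePow_add _ (m * k + m * k), minusOnePow_add_self, mul_one]

/-- Replacing `d` by `d + c` turns `⌊d k / c⌋` into `⌊d k / c⌋ + k`, which cancels the factor
`(-1) ^ k` in the summand of `S`. -/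
lemma hardyS_add_self (d : ℤ) {c : ℕ} (hc : 0 < c) :
    hardyS (d + c) c = -hardyS4 d c := by
  rw [hardyS_eq, hardyS4_eq, ← Finset.sum_neg_distrib]
  refine Finset.sum_congr rfl fun k _ => ?_
  have : (d + c) * k / (c : ℤ) = d * k / c + k := by
    rw [← Int.add_mul_ediv_right _ _ (by positivity)]
    ring_nf
  rw [this, show k + 1 + (d * k / c + k) = (k + k) + (1 + d * k / c) by ring, minusOnePow_add,
    minusOnePow_add_self, minusOnePow_add, minusOnePow_one]
  ring

lemma hardyS_neg {d : ℤ} {c : ℕ} (h : IsCoprime d c) :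
    hardyS (-d) c = -hardyS d c := by
  rw [hardyS_eq, hardyS_eq, ← Finset.sum_neg_distrib]
  refine Finset.sum_congr rfl fun k hk => ?_
  rw [Finset.mem_Icc] at hk
  have hcpos : (0 : ℤ) < c := by lia
  -- `d k / c` is not an integer, so `⌊-x⌋ = -⌊x⌋ - 1` at this point
  have hnd : ¬ (c : ℤ) ∣ d * k := fun hd =>
    absurd (Int.le_of_dvd (by lia) (h.symm.dvd_of_dvd_mul_left hd)) (by lia)
  have hr : 0 < d * k % c := lt_of_le_of_ne (Int.emod_nonneg _ hcpos.ne')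
    fun h0 => hnd (Int.dvd_of_emod_eq_zero h0.symm)
  have hr' := Int.emod_lt_of_pos (d * k) hcpos
  have hdm := Int.mul_ediv_add_emod (d * k) c
  have : -d * k / (c : ℤ) = -(d * k / c) + -1 := by
    refine Int.ediv_eq_iff_of_pos hcpos |>.2 ⟨?_, ?_⟩ <;> nlinarith
  rw [this, ← add_assoc, minusOnePow_add _ (-1), minusOnePow_neg, minusOnePow_one,
    minusOnePow_add, minusOnePow_neg, ← minusOnePow_add]
  ring

lemma hardyS_natCast (d c : ℕ) :
    hardyS d c = -∑ k ∈ Finset.Ico 1 c, (-1) ^ (k + d * k / c) := by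
  rw [hardyS_eq, ← Finset.sum_neg_distrib]
  refine (Finset.sum_nbij' (fun k : ℕ => (k : ℤ)) Int.toNat ?_ ?_ ?_ ?_ ?_).symm
  · intro k hk
    rw [Finset.mem_Ico] at hk
    rw [Finset.mem_Icc]
    lia
  · intro k hk
    rw [Finset.mem_Icc] at hk
    rw [Finset.mem_Ico]
    lia
  · intro k _
    simp
  · intro k hk
    rw [Finset.mem_Icc] at hk
    simp
    lia
  · intro k _
    rw [show (k : ℤ) + 1 + (d : ℤ) * k / c = ((k + d * k / c + 1 : ℕ) : ℤ) by push_cast; ring,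
      minusOnePow_natCast, pow_succ]
    ring

lemma sum_multiples {a b : ℕ} (ha : 0 < a) (f : ℕ → ℤ) :
    ∑ t ∈ Finset.Ico 1 (a * b), (if a ∣ t then f t else 0) =
      ∑ k ∈ Finset.Ico 1 b, f (a * k) := by
  rw [← Finset.sum_filter]
  refine (Finset.sum_nbij' (fun k => a * k) (fun t => t / a) ?_ ?_ ?_ ?_ ?_).symm
  · intro k hk
    simp only [Finset.mem_Ico, Finset.mem_filter] at hk ⊢
    exact ⟨⟨Nat.mul_pos ha hk.1, Nat.mul_lt_mul_of_pos_left hk.2 ha⟩, dvd_mul_right _ _⟩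
  · intro t ht
    simp only [Finset.mem_Ico, Finset.mem_filter] at ht ⊢
    obtain ⟨⟨h1, h2⟩, k, rfl⟩ := ht
    rw [Nat.mul_div_cancel_left _ ha]
    exact ⟨Nat.pos_of_mul_pos_left h1, Nat.lt_of_mul_lt_mul_left h2⟩
  · intro k _
    exact Nat.mul_div_cancel_left _ ha
  · intro t ht
    exact Nat.mul_div_cancel' (Finset.mem_filter.1 ht).2
  · intro k _
    rfl

/-- Hardy's reciprocity law. The sign `(-1) ^ (⌊t / a⌋ + ⌊t / b⌋)` flips, as `t` grows from `0` to
`a b - 1`, exactly at the multiples of `a` and at those of `b`; the two sums collect its values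
there, and the total change is determined by the parity of `a + b`. -/
theorem hardyS_reciprocity {a b : ℕ} (ha : 0 < a) (hb : 0 < b) (hab : a.Coprime b)
    (hodd : Odd (a + b)) : hardyS a b + hardyS b a = 1 := by
  set f : ℕ → ℤ := fun t => (-1) ^ (t / a + t / b) with hf
  have hstep : ∀ t ∈ Finset.Ico 1 (a * b), f t - f (t - 1) =
      (if a ∣ t then 2 * f t else 0) + (if b ∣ t then 2 * f t else 0) := by
    intro t ht
    rw [Finset.mem_Ico] at ht
    obtain ⟨s, rfl⟩ : ∃ s, t = s + 1 := ⟨t - 1, by lia⟩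
    have hnot : ¬ (a ∣ s + 1 ∧ b ∣ s + 1) := fun h =>
      absurd (Nat.le_of_dvd (by lia) (hab.mul_dvd_of_dvd_of_dvd h.1 h.2)) (by lia)
    simp only [hf, Nat.succ_div, Nat.add_sub_cancel]
    by_cases h1 : a ∣ s + 1 <;> by_cases h2 : b ∣ s + 1
    · exact absurd ⟨h1, h2⟩ hnot
    all_goals
      simp only [h1, h2, if_true, if_false, pow_add, pow_one, pow_zero]
      ring
  have htel : ∑ t ∈ Finset.Ico 1 (a * b), (f t - f (t - 1)) = f (a * b - 1) - f 0 := by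
    rw [← Finset.sum_range_sub, Finset.sum_Ico_eq_sum_range]
    refine Finset.sum_congr rfl fun t _ => ?_
    rw [Nat.add_sub_cancel_left, add_comm]
  have hlast : f (a * b - 1) = -1 := by
    have h1 : (a * b - 1) / a = b - 1 := by
      have := Nat.mul_sub_div 0 a b (Nat.mul_pos ha hb)
      simpa using this
    have h2 : (a * b - 1) / b = a - 1 := by
      have := Nat.mul_sub_div 0 b a (Nat.mul_pos hb ha)
      simpa [mul_comm] using this
    simp only [hf, h1, h2]
    exact Odd.neg_one_pow (by rw [Nat.odd_iff] at hodd ⊢; lia)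
  have h0 : f 0 = 1 := by simp [hf]
  have hA : ∑ k ∈ Finset.Ico 1 b, f (a * k) = -hardyS a b := by
    rw [hardyS_natCast, neg_neg]
    exact Finset.sum_congr rfl fun k _ => by simp only [hf, Nat.mul_div_cancel_left _ ha]
  have hB : ∑ k ∈ Finset.Ico 1 a, f (b * k) = -hardyS b a := by
    rw [hardyS_natCast, neg_neg]
    exact Finset.sum_congr rfl fun k _ => by
      simp only [hf, Nat.mul_div_cancel_left _ hb, add_comm]
  rw [Finset.sum_congr rfl hstep, Finset.sum_add_distrib, sum_multiples ha (fun t => 2 * f t),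
    mul_comm a b, sum_multiples hb (fun t => 2 * f t), ← Finset.mul_sum, ← Finset.mul_sum, hA, hB,
    mul_comm b a, hlast, h0] at htel
  lia

lemma num_add_intCast (x : ℚ) (m : ℤ) : (x + m).num = x.num + m * x.den := by
  have h := Rat.num_div_eq_of_coprime (a := x.num + m * x.den) (b := x.den)
    (by exact_mod_cast x.den_pos) (by
      rw [← Int.isCoprime_iff_nat_coprime]
      exact (IsCoprime.add_mul_right_left_iff).2
        (Int.isCoprime_iff_nat_coprime.2 (by simpa using x.reduced)))
  rw [← h]
  congr 1
  have : (x.den : ℚ) ≠ 0 := by exact_mod_cast x.den_ne_zero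
  push_cast
  rw [add_div, Rat.num_div_den, mul_div_cancel_right₀ _ this]

lemma num_inv_of_pos {x : ℚ} (hx : 0 < x) : (x⁻¹).num = x.den := by
  rw [Rat.num_inv, Int.sign_eq_one_of_pos (Rat.num_pos.2 hx), one_mul]

lemma den_inv_eq_abs {x : ℚ} (hx : x ≠ 0) : ((x⁻¹).den : ℤ) = |x.num| := by
  rw [Rat.den_inv_of_ne_zero hx, Int.natCast_natAbs]

lemma ratS_add_two_mul (x : ℚ) (m : ℤ) : ratS (x + 2 * m) = ratS x := by
  have h : x + 2 * m = x + ((2 * m : ℤ) : ℚ) := by push_cast; ring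
  rw [ratS, h, Rat.add_intCast_den, num_add_intCast, hardyS_add _ _ x.den_pos, ratS]

lemma ratS_neg (x : ℚ) : ratS (-x) = -ratS x := by
  rw [ratS, Rat.neg_num, Rat.neg_den,
    hardyS_neg (Int.isCoprime_iff_nat_coprime.2 (by simpa using x.reduced)), ratS]

lemma ratS4_eq (x : ℚ) : ratS4 x = -ratS (x + 1) := by
  have h : x + 1 = x + ((1 : ℤ) : ℚ) := by push_cast; ring
  rw [ratS, h, Rat.add_intCast_den, num_add_intCast, one_mul, hardyS_add_self _ x.den_pos,
    neg_neg, ratS4]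

lemma ratS4_add_two_mul (x : ℚ) (m : ℤ) : ratS4 (x + 2 * m) = ratS4 x := by
  rw [ratS4_eq, ratS4_eq, add_right_comm, ratS_add_two_mul]

lemma ratS4_neg (x : ℚ) : ratS4 (-x) = -ratS4 x := by
  have e : -x + 1 = -(x + 1) + 2 * (1 : ℤ) := by push_cast; ring
  rw [ratS4_eq, ratS4_eq, e, ratS_add_two_mul, ratS_neg]

/-- The reciprocity law for the function `S` on rationals. The integer sign of `x` is written as
the sign of its numerator. -/
lemma ratS_inv {x : ℚ} (hx : x ≠ 0) (hodd : Odd (x.num + x.den)) :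
    ratS x⁻¹ = x.num.sign - ratS x := by
  have pos : ∀ y : ℚ, 0 < y → Odd (y.num + y.den) → ratS y⁻¹ = 1 - ratS y := by
    intro y hy ho
    obtain ⟨a, ha⟩ := Int.eq_ofNat_of_zero_le (Rat.num_nonneg.2 hy.le)
    have hapos : 0 < a := by
      have := Rat.num_pos.2 hy
      lia
    have hred := y.reduced
    rw [ha, Int.natAbs_natCast] at hred
    have := hardyS_reciprocity hapos y.den_pos hred (by rw [ha] at ho; exact_mod_cast ho)
    rw [ratS, num_inv_of_pos hy, den_inv_eq_abs hy.ne', ratS, ha, abs_of_nonneg (by positivity)]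
    lia
  rcases hx.lt_or_gt with h | h
  · have := pos (-x) (by linarith) (by
      rw [Rat.neg_num, Rat.neg_den]
      have e : -x.num + (x.den : ℤ) = (x.num + x.den) - 2 * x.num := by ring
      rw [e]
      exact hodd.sub_even (even_two_mul _))
    rw [inv_neg, ratS_neg, ratS_neg] at this
    rw [Int.sign_eq_neg_one_of_neg (Rat.num_neg.2 h)]
    lia
  · rw [pos x h hodd, Int.sign_eq_one_of_pos (Rat.num_pos.2 h)]

/-! ### Expansions with even negative partial quotients -/

lemma sum_Icc_one_succ (f : ℕ → ℤ) (n : ℕ) :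
    ∑ k ∈ Finset.Icc 1 (n + 1), f k = f 1 + ∑ k ∈ Finset.Icc 1 n, f (k + 1) := by
  induction n with
  | zero => simp
  | succ n ih =>
    rw [Finset.sum_Icc_succ_top (by lia), ih, Finset.sum_Icc_succ_top (by lia), add_assoc]

lemma sign_num_eq_of_abs_sub_le {y : ℚ} {m : ℤ} (hm : m ≠ 0) (h : |y - 2 * m| ≤ 1) :
    y.num.sign = m.sign := by
  rw [abs_le] at h
  rcases hm.lt_or_gt with h0 | h0
  · have : (m : ℚ) ≤ -1 := by exact_mod_cast (show m ≤ -1 by lia)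
    rw [Int.sign_eq_neg_one_of_neg h0, Int.sign_eq_neg_one_of_neg (Rat.num_neg.2 (by linarith))]
  · have : (1 : ℚ) ≤ m := by exact_mod_cast h0
    rw [Int.sign_eq_one_of_pos h0, Int.sign_eq_one_of_pos (Rat.num_pos.2 (by linarith))]

lemma two_le_abs_two_mul {m : ℤ} (hm : m ≠ 0) : (2 : ℚ) ≤ |2 * (m : ℚ)| := by
  have : (1 : ℚ) ≤ |(m : ℚ)| := by exact_mod_cast Int.one_le_abs hm
  rw [abs_mul, abs_two]
  linarith

lemma isThetaExpansion_zero {x : ℚ} {e : ℕ → ℤ} : IsThetaExpansion x 0 e ↔ x = 2 * e 0 := by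
  simp only [IsThetaExpansion, negContFrac, Int.cast_mul, Int.cast_ofNat]
  exact ⟨fun h => h.2, fun h => ⟨fun k h1 h2 => by lia, h⟩⟩

lemma isThetaExpansion_succ {x : ℚ} {n : ℕ} {e : ℕ → ℤ} :
    IsThetaExpansion x (n + 1) e ↔
      e 1 ≠ 0 ∧ ∃ y, IsThetaExpansion y n (fun k => e (k + 1)) ∧ x = 2 * e 0 - 1 / y := by
  simp only [IsThetaExpansion, negContFrac, Int.cast_mul, Int.cast_ofNat]
  constructor
  · rintro ⟨h, hx⟩
    exact ⟨h 1 le_rfl (by lia), _, ⟨fun k h1 h2 => h _ (by lia) (by lia), rfl⟩, hx⟩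
  · rintro ⟨h1, y, ⟨h, rfl⟩, hx⟩
    refine ⟨fun k hk hkn => ?_, hx⟩
    obtain rfl | hk1 := eq_or_ne k 1
    · exact h1
    · obtain ⟨j, rfl⟩ : ∃ j, k = j + 1 := ⟨k - 1, by lia⟩
      exact h j (by lia) (by lia)

lemma IsThetaExpansion.abs_sub_lt_one {x : ℚ} {n : ℕ} {e : ℕ → ℤ} (h : IsThetaExpansion x n e) :
    |x - 2 * e 0| < 1 := by
  induction n generalizing x e with
  | zero => simp [isThetaExpansion_zero.1 h]
  | succ n ih =>
    obtain ⟨h1, y, hy, rfl⟩ := isThetaExpansion_succ.1 h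
    have hy1 : 1 < |y| := by
      have := ih hy
      have h2 := two_le_abs_two_mul h1
      have := abs_sub_abs_le_abs_sub (2 * (e 1 : ℚ)) y
      rw [abs_sub_comm] at this
      simp only [zero_add] at *
      linarith
    rw [show 2 * (e 0 : ℚ) - 1 / y - 2 * e 0 = -(1 / y) by ring, abs_neg, abs_div, abs_one]
    exact (div_lt_one (by linarith)).2 hy1

/-- All complete quotients after the first have absolute value greater than `1`; in particular
they do not vanish. -/
lemma IsThetaExpansion.one_lt_abs {x : ℚ} {n : ℕ} {e : ℕ → ℤ} (h : IsThetaExpansion x n e)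
    (h0 : e 0 ≠ 0) : 1 < |x| := by
  have h1 := h.abs_sub_lt_one
  have h2 := two_le_abs_two_mul h0
  have := abs_sub_abs_le_abs_sub (2 * (e 0 : ℚ)) x
  rw [abs_sub_comm] at this
  linarith

lemma eq_of_abs_sub_two_mul_lt {x : ℚ} {a b : ℤ} (ha : |x - 2 * a| < 1) (hb : |x - 2 * b| < 1) :
    a = b := by
  rw [abs_lt] at ha hb
  have h1 : a < b + 1 := by
    have : (a : ℚ) < b + 1 := by linarith
    exact_mod_cast this
  have h2 : b < a + 1 := by
    have : (b : ℚ) < a + 1 := by linarith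
    exact_mod_cast this
  lia

/-- Uniqueness: `2 e 0` is the only even integer at distance less than `1` from `x`, and it
determines the next complete quotient. -/
theorem IsThetaExpansion.unique {x : ℚ} {n m : ℕ} {e f : ℕ → ℤ} (he : IsThetaExpansion x n e)
    (hf : IsThetaExpansion x m f) : n = m ∧ ∀ k ≤ n, e k = f k := by
  induction n generalizing x m e f with
  | zero =>
    have h0 := eq_of_abs_sub_two_mul_lt he.abs_sub_lt_one hf.abs_sub_lt_one
    cases m with
    | zero => exact ⟨rfl, fun k hk => by rw [Nat.le_zero.1 hk, h0]⟩
    | succ m =>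
      obtain ⟨h1, y, hy, hx⟩ := isThetaExpansion_succ.1 hf
      have hy1 := hy.one_lt_abs h1
      rw [isThetaExpansion_zero.1 he, h0] at hx
      have hy0 : y = 0 := by simpa using sub_eq_self.1 hx.symm
      norm_num [hy0] at hy1
  | succ n ih =>
    have h0 := eq_of_abs_sub_two_mul_lt he.abs_sub_lt_one hf.abs_sub_lt_one
    obtain ⟨h1, y, hy, hx⟩ := isThetaExpansion_succ.1 he
    cases m with
    | zero =>
      have hy1 := hy.one_lt_abs h1
      rw [isThetaExpansion_zero.1 hf, ← h0] at hx
      have hy0 : y = 0 := by simpa using sub_eq_self.1 hx.symm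
      norm_num [hy0] at hy1
    | succ m =>
      obtain ⟨h1', y', hy', hx'⟩ := isThetaExpansion_succ.1 hf
      have hyy : y = y' := by
        rw [hx, h0] at hx'
        simpa using hx'
      subst hyy
      obtain ⟨rfl, hk⟩ := ih hy hy'
      refine ⟨rfl, fun k hkn => ?_⟩
      cases k with
      | zero => exact h0
      | succ k => exact hk k (by lia)

lemma odd_num_add_den_neg {x : ℚ} (h : Odd (x.num + x.den)) : Odd ((-x).num + (-x).den) := by
  rw [Rat.neg_num, Rat.neg_den]
  grind

lemma odd_num_add_den_sub {x : ℚ} (m : ℤ) (h : Odd (x.num + x.den)) :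
    Odd ((x - 2 * m).num + (x - 2 * m).den) := by
  have e : x - 2 * m = x + ((-2 * m : ℤ) : ℚ) := by push_cast; ring
  rw [e, num_add_intCast, Rat.add_intCast_den,
    show x.num + -2 * m * x.den + x.den = (x.num + x.den) - 2 * (m * x.den) by ring]
  exact h.sub_even (even_two_mul _)

lemma odd_num_add_den_inv {x : ℚ} (hx : x ≠ 0) (h : Odd (x.num + x.den)) :
    Odd ((x⁻¹).num + (x⁻¹).den) := by
  rw [Rat.num_inv, den_inv_eq_abs hx]
  rcases (Rat.num_ne_zero.2 hx).lt_or_gt with h0 | h0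
  · rw [Int.sign_eq_neg_one_of_neg h0, abs_of_neg h0,
      show -1 * (x.den : ℤ) + -x.num = -(x.num + x.den) by ring]
    exact h.neg
  · rw [Int.sign_eq_one_of_pos h0, abs_of_pos h0, one_mul, add_comm]
    exact h

lemma exists_abs_sub_two_mul_le (x : ℚ) : ∃ m : ℤ, |x - 2 * m| ≤ 1 := by
  refine ⟨round (x / 2), ?_⟩
  have := abs_sub_round (x / 2)
  rw [abs_le] at this ⊢
  constructor <;> linarith

lemma eq_intCast_of_abs_eq_one {w : ℚ} (h : |w| = 1) : w.den = 1 ∧ Odd w.num := by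
  rcases (abs_eq (by norm_num)).1 h with rfl | rfl
  · decide
  · decide

lemma abs_num_lt_den {w : ℚ} (h : |w| < 1) : |w.num| < w.den := by
  have hd : (0 : ℚ) < w.den := by exact_mod_cast w.den_pos
  rw [← Rat.num_div_den w, abs_div, abs_of_pos hd, div_lt_one hd] at h
  exact_mod_cast h

theorem exists_isThetaExpansion {x : ℚ} (h : Odd (x.num + x.den)) :
    ∃ (n : ℕ) (e : ℕ → ℤ), IsThetaExpansion x n e := by
  induction hN : x.den using Nat.strong_induction_on generalizing x with
  | _ N ih =>
    obtain ⟨m, hm⟩ := exists_abs_sub_two_mul_le x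
    have hw := odd_num_add_den_sub m h
    -- `x` is not an odd integer, so the nearest even integer has distance less than `1`
    have hlt : |x - 2 * m| < 1 := lt_of_le_of_ne hm fun h1 => by
      obtain ⟨h2, h3⟩ := eq_intCast_of_abs_eq_one h1
      rw [h2] at hw
      exact (Int.not_even_iff_odd.2 hw) (h3.add_odd odd_one)
    by_cases h0 : x - 2 * m = 0
    · exact ⟨0, fun _ => m, isThetaExpansion_zero.2 (by linarith)⟩
    have hden : ((-(x - 2 * m)⁻¹).den : ℤ) < N := by
      rw [Rat.neg_den, den_inv_eq_abs h0]
      refine (abs_num_lt_den hlt).trans_eq ?_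
      have e : x - 2 * m = x + ((-2 * m : ℤ) : ℚ) := by push_cast; ring
      rw [e, Rat.add_intCast_den, hN]
    obtain ⟨n, e, he⟩ := ih _ (by exact_mod_cast hden)
      (odd_num_add_den_neg (odd_num_add_den_inv h0 hw)) rfl
    refine ⟨n + 1, fun k => Nat.casesOn k m e, isThetaExpansion_succ.2 ⟨fun h1 => ?_, _, he, ?_⟩⟩
    · have h2 := he.abs_sub_lt_one
      replace h1 : e 0 = 0 := h1
      rw [h1, Int.cast_zero, mul_zero, sub_zero, abs_neg, abs_inv] at h2
      exact absurd (one_lt_inv₀ (abs_pos.2 h0) |>.2 hlt) (by linarith)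
    · simp

theorem IsThetaExpansion.ratS_eq {x : ℚ} {n : ℕ} {e : ℕ → ℤ} (h : IsThetaExpansion x n e)
    (hodd : Odd (x.num + x.den)) : ratS x = -∑ k ∈ Finset.Icc 1 n, (e k).sign := by
  induction n generalizing x e with
  | zero =>
    rw [isThetaExpansion_zero.1 h, ← zero_add (2 * (e 0 : ℚ)), ratS_add_two_mul]
    simp [ratS, hardyS]
  | succ n ih =>
    obtain ⟨h1, y, hy, hx⟩ := isThetaExpansion_succ.1 h
    have hy1 := hy.one_lt_abs h1
    have hy0 : y ≠ 0 := by
      rintro rfl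
      norm_num at hy1
    have hxy : x - 2 * e 0 = -y⁻¹ := by rw [hx]; ring
    have hyo : Odd (y.num + y.den) := by
      have h2 := odd_num_add_den_neg (odd_num_add_den_sub (e 0) hodd)
      rw [hxy, neg_neg] at h2
      simpa only [inv_inv] using odd_num_add_den_inv (inv_ne_zero hy0) h2
    have hs : y.num.sign = (e 1).sign := sign_num_eq_of_abs_sub_le h1 hy.abs_sub_lt_one.le
    have hxe : x = -y⁻¹ + 2 * e 0 := by rw [← hxy]; ring
    rw [hxe, ratS_add_two_mul, ratS_neg, ratS_inv hy0 hyo, ih hy hyo, sum_Icc_one_succ, hs]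
    ring

/-! ### Expansions with even partial quotients at even places -/

lemma isGammaTwoExpansion_one {x : ℚ} {a : ℕ → ℤ} :
    IsGammaTwoExpansion x 1 a ↔ a 1 ≠ 0 ∧ x = 2 * a 0 + 1 / a 1 := by
  have e : contFrac (fun k => if Even k then 2 * a k else a k) 1 = 2 * a 0 + 1 / a 1 := by
    simp [contFrac]
  rw [IsGammaTwoExpansion, e]
  constructor
  · rintro ⟨-, h, -, hx⟩
    exact ⟨h 1 le_rfl le_rfl, hx⟩
  · rintro ⟨h, hx⟩
    refine ⟨odd_one, fun k h1 h2 => ?_, fun k h1 h2 => ?_, hx⟩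
    · rw [le_antisymm h2 h1]
      exact h
    · exact absurd h1.pos (by lia)

lemma isGammaTwoExpansion_add_two {x : ℚ} {n : ℕ} {a : ℕ → ℤ} (_hn : 0 < n) :
    IsGammaTwoExpansion x (n + 2) a ↔ 1 < |a 1| ∧ a 2 ≠ 0 ∧
      ∃ y, IsGammaTwoExpansion y n (fun k => a (k + 2)) ∧ x = 2 * a 0 + 1 / (a 1 + 1 / y) := by
  have e : contFrac (fun k => if Even k then 2 * a k else a k) (n + 2) = 2 * a 0 +
      1 / (a 1 + 1 / contFrac (fun k => if Even k then 2 * a (k + 2) else a (k + 2)) n) := by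
    simp [contFrac, add_assoc, Nat.even_add_one]
  rw [IsGammaTwoExpansion, e]
  constructor
  · rintro ⟨ho, h, h', hx⟩
    exact ⟨h' 1 odd_one (by lia), h 2 (by lia) (by lia), _,
      ⟨by grind, fun k h1 h2 => h _ (by lia) (by lia),
        fun k h1 h2 => h' _ (by grind) (by lia), rfl⟩, hx⟩
  · rintro ⟨h1, h2, y, ⟨ho, h, h', rfl⟩, hx⟩
    refine ⟨by grind, fun k hk hkn => ?_, fun k hk hkn => ?_, hx⟩
    · rcases k with _ | _ | _ | k
      · lia
      · rintro h0
        norm_num [h0] at h1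
      · exact h2
      · exact h (k + 1) (by lia) (by lia)
    · rcases k with _ | _ | k
      · exact absurd hk (by decide)
      · exact h1
      · exact h' k (by grind) (by lia)

/-- Induction along the expansion, two partial quotients at a time. -/
lemma IsGammaTwoExpansion.rec_two {P : ℚ → ℕ → (ℕ → ℤ) → Prop}
    (one : ∀ (x : ℚ) (a : ℕ → ℤ), a 1 ≠ 0 → x = 2 * a 0 + 1 / a 1 → P x 1 a)
    (step : ∀ (x y : ℚ) (n : ℕ) (a : ℕ → ℤ), 1 < |a 1| → a 2 ≠ 0 →
      IsGammaTwoExpansion y n (fun k => a (k + 2)) → P y n (fun k => a (k + 2)) →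
      x = 2 * a 0 + 1 / (a 1 + 1 / y) → P x (n + 2) a)
    {x : ℚ} {n : ℕ} {a : ℕ → ℤ} (h : IsGammaTwoExpansion x n a) : P x n a := by
  obtain ⟨m, rfl⟩ := h.1
  induction m generalizing x a with
  | zero =>
    obtain ⟨h1, hx⟩ := isGammaTwoExpansion_one.1 h
    exact one x a h1 hx
  | succ m ih =>
    obtain ⟨h1, h2, y, hy, hx⟩ := (isGammaTwoExpansion_add_two (by lia)).1 h
    exact step x y _ a h1 h2 hy (ih hy) hx

lemma IsGammaTwoExpansion.abs_sub_le_one {x : ℚ} {n : ℕ} {a : ℕ → ℤ}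
    (h : IsGammaTwoExpansion x n a) : |x - 2 * a 0| ≤ 1 := by
  refine h.rec_two (P := fun x _ a => |x - 2 * a 0| ≤ 1) ?_ ?_
  · rintro x a h1 rfl
    have : (1 : ℚ) ≤ |(a 1 : ℚ)| := by exact_mod_cast Int.one_le_abs h1
    rw [add_sub_cancel_left, abs_div, abs_one]
    exact div_le_one_of_le₀ this (abs_nonneg _)
  · rintro x y n a h1 h2 - hy rfl
    have hy1 : 1 ≤ |y| := by
      have h3 := two_le_abs_two_mul h2
      have h4 := abs_sub_abs_le_abs_sub (2 * (a 2 : ℚ)) y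
      rw [abs_sub_comm] at h4
      simp only [zero_add] at hy
      linarith
    have hy2 : |1 / y| ≤ 1 := by
      rw [abs_div, abs_one]
      exact div_le_one_of_le₀ hy1 (abs_nonneg _)
    have ha : (2 : ℚ) ≤ |(a 1 : ℚ)| := by exact_mod_cast h1
    have h5 := abs_sub_abs_le_abs_sub (a 1 : ℚ) (-(1 / y))
    rw [abs_neg, sub_neg_eq_add] at h5
    rw [add_sub_cancel_left, abs_div, abs_one]
    exact div_le_one_of_le₀ (by linarith) (abs_nonneg _)

/-- All complete quotients at positive even places have absolute value at least `1`; in particular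
they do not vanish. -/
lemma IsGammaTwoExpansion.one_le_abs {x : ℚ} {n : ℕ} {a : ℕ → ℤ} (h : IsGammaTwoExpansion x n a)
    (h0 : a 0 ≠ 0) : 1 ≤ |x| := by
  have h1 := h.abs_sub_le_one
  have h2 := two_le_abs_two_mul h0
  have := abs_sub_abs_le_abs_sub (2 * (a 0 : ℚ)) x
  rw [abs_sub_comm] at this
  linarith

lemma odd_num_sub {x : ℚ} (m : ℤ) (h : Odd x.num) : Odd (x - 2 * m).num := by
  have e : x - 2 * m = x + ((-2 * m : ℤ) : ℚ) := by push_cast; ring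
  rw [e, num_add_intCast, show x.num + -2 * m * x.den = x.num - 2 * (m * x.den) by ring]
  exact h.sub_even (even_two_mul _)

lemma odd_den_inv {x : ℚ} (h : Odd x.num) : Odd (x⁻¹).den := by
  have hx : x ≠ 0 := by
    rintro rfl
    exact absurd h (by decide)
  rw [Rat.den_inv_of_ne_zero hx]
  exact Int.natAbs_odd.2 h

lemma odd_num_inv {x : ℚ} (hx : x ≠ 0) (h : Odd x.den) : Odd (x⁻¹).num := by
  have h' : Odd (x.den : ℤ) := by exact_mod_cast h
  rw [Rat.num_inv]
  rcases (Rat.num_ne_zero.2 hx).lt_or_gt with h0 | h0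
  · rw [Int.sign_eq_neg_one_of_neg h0, neg_one_mul]
    exact h'.neg
  · rw [Int.sign_eq_one_of_pos h0, one_mul]
    exact h'

lemma exists_abs_sub_lt_of_one_lt {z : ℚ} (hz : 1 < |z|) : ∃ m : ℤ, 1 < |m| ∧ |z - m| < 1 := by
  -- round away from zero
  rcases lt_abs.1 hz with h | h
  · have h1 := Int.le_ceil z
    have h2 := Int.ceil_lt_add_one z
    have h3 : 1 < ⌈z⌉ := Int.lt_ceil.2 (by exact_mod_cast h)
    refine ⟨⌈z⌉, lt_of_lt_of_le h3 (le_abs_self _), ?_⟩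
    rw [abs_lt]
    constructor <;> linarith
  · have h1 := Int.floor_le z
    have h2 := Int.lt_floor_add_one z
    have h3 : ⌊z⌋ < -1 := Int.floor_lt.2 (by push_cast; linarith)
    refine ⟨⌊z⌋, lt_of_lt_of_le (by lia) (neg_le_abs _), ?_⟩
    rw [abs_lt]
    constructor <;> linarith

theorem exists_isGammaTwoExpansion {x : ℚ} (h : Odd x.num) :
    ∃ (n : ℕ) (a : ℕ → ℤ), IsGammaTwoExpansion x n a := by
  induction hN : x.den using Nat.strong_induction_on generalizing x with
  | _ N ih =>
    obtain ⟨m, hm⟩ := exists_abs_sub_two_mul_le x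
    have hw := odd_num_sub m h
    set w := x - 2 * m with hwdef
    have hxw : x = 2 * m + w := by rw [hwdef]; ring
    have hw0 : w ≠ 0 := by
      intro h0
      rw [h0] at hw
      exact absurd hw (by decide)
    have hwN : w.den = N := by
      have e : w = x + ((-2 * m : ℤ) : ℚ) := by rw [hwdef]; push_cast; ring
      rw [e, Rat.add_intCast_den, hN]
    have hzo : Odd (w⁻¹).den := odd_den_inv hw
    by_cases hz1 : (w⁻¹).den = 1
    · have hz : ((w⁻¹).num : ℚ) = w⁻¹ := Rat.coe_int_num_of_den_eq_one hz1
      refine ⟨1, fun k => Nat.casesOn k m fun _ => (w⁻¹).num,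
        isGammaTwoExpansion_one.2 ⟨?_, ?_⟩⟩
      · exact Rat.num_ne_zero.2 (inv_ne_zero hw0)
      · change x = 2 * (m : ℚ) + 1 / ((w⁻¹).num : ℚ)
        rw [hz, one_div, inv_inv]
        exact hxw
    have hw1 : |w| < 1 := lt_of_le_of_ne hm fun h1 => hz1 (by
      rcases (abs_eq (by norm_num)).1 h1 with h2 | h2
      · rw [h2, inv_one, Rat.den_one]
      · rw [h2, inv_neg, inv_one, Rat.neg_den, Rat.den_one])
    have hz : 1 < |w⁻¹| := by
      rw [abs_inv]
      exact (one_lt_inv₀ (abs_pos.2 hw0)).2 hw1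
    obtain ⟨b, hb, hzb⟩ := exists_abs_sub_lt_of_one_lt hz
    have hvd : (w⁻¹ - b).den = (w⁻¹).den := by
      have e : w⁻¹ - b = w⁻¹ + ((-b : ℤ) : ℚ) := by push_cast; ring
      rw [e, Rat.add_intCast_den]
    have hv0 : w⁻¹ - b ≠ 0 := by
      intro h0
      rw [h0] at hvd
      exact hz1 hvd.symm
    have hden : (((w⁻¹ - b)⁻¹).den : ℤ) < N := by
      rw [den_inv_eq_abs hv0]
      refine (abs_num_lt_den hzb).trans ?_
      rw [hvd, den_inv_eq_abs hw0, ← hwN]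
      exact abs_num_lt_den hw1
    obtain ⟨n, a, ha⟩ := ih _ (by exact_mod_cast hden)
      (odd_num_inv hv0 (by rw [hvd]; exact hzo)) rfl
    refine ⟨n + 2, fun k => Nat.casesOn k m fun j => Nat.casesOn j b a,
      (isGammaTwoExpansion_add_two ha.1.pos).2 ⟨hb, fun h1 => ?_, _, ha, ?_⟩⟩
    · replace h1 : a 0 = 0 := h1
      have h2 := ha.abs_sub_le_one
      rw [h1, Int.cast_zero, mul_zero, sub_zero, abs_inv] at h2
      exact absurd ((one_lt_inv₀ (abs_pos.2 hv0)).2 hzb) (by linarith)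
    · simpa using hxw

/-- One step of the cocycle: with `u = 1 + 1 / z`, reciprocity relates `u` and
`u⁻¹ = 1 - 1 / (z + 1)`, and `S₄(1 / z) = -S(u)`. -/
lemma ratS4_inv_add_one {z : ℚ} (hz : z ≠ 0) (hz1 : z + 1 ≠ 0) (ho : Odd z.den) :
    ratS4 (z + 1)⁻¹ = ratS4 z⁻¹ + (z⁻¹ + 1).num.sign := by
  have hu : (z⁻¹ + 1) ≠ 0 := by
    intro h
    apply hz1
    field_simp at h
    linarith
  have huo : Odd ((z⁻¹ + 1).num + (z⁻¹ + 1).den) := by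
    have e : z⁻¹ + 1 = z⁻¹ + ((1 : ℤ) : ℚ) := by push_cast; ring
    have := odd_num_inv hz ho
    rw [e, num_add_intCast, Rat.add_intCast_den, one_mul, add_assoc, ← two_mul]
    exact this.add_even (even_two_mul _)
  have e : (z⁻¹ + 1)⁻¹ = -((z + 1)⁻¹ + 1) + 2 * (1 : ℤ) := by
    have : 1 + z ≠ 0 := by rwa [add_comm]
    push_cast
    field_simp
    ring
  have h := ratS_inv hu huo
  rw [e, ratS_add_two_mul, ratS_neg, ← ratS4_eq] at h
  rw [h, ratS4_eq z⁻¹]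
  ring

lemma ratS4_inv_add_natCast {w : ℚ} (hw : 0 < w) (ho : Odd w.den) (a : ℕ) :
    ratS4 (w + a)⁻¹ = ratS4 w⁻¹ + a := by
  induction a with
  | zero => simp
  | succ a ih =>
    have hpos : 0 < w + a := by positivity
    have hd : Odd (w + a).den := by rwa [Rat.add_natCast_den]
    rw [Nat.cast_succ, ← add_assoc, ratS4_inv_add_one hpos.ne' (by positivity) hd, ih,
      Int.sign_eq_one_of_pos (Rat.num_pos.2 (by positivity)), Nat.cast_succ, add_assoc]

lemma ratS4_one : ratS4 1 = 0 := by
  simp [ratS4, hardyS4]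

lemma ratS4_inv_intCast {a : ℤ} (ha : a ≠ 0) : ratS4 (a : ℚ)⁻¹ = a - a.sign := by
  have pos : ∀ n : ℕ, ratS4 ((n + 1 : ℕ) : ℚ)⁻¹ = n := by
    intro n
    have := ratS4_inv_add_natCast one_pos odd_one n
    rw [inv_one, ratS4_one, zero_add] at this
    rw [← this, Nat.cast_succ, add_comm]
  rcases ha.lt_or_gt with h | h
  · obtain ⟨n, rfl⟩ : ∃ n : ℕ, a = -((n + 1 : ℕ) : ℤ) := ⟨(-a).toNat - 1, by lia⟩
    rw [Int.cast_neg, Int.cast_natCast, inv_neg, ratS4_neg, pos, Int.sign_eq_neg_one_of_neg h]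
    push_cast
    ring
  · obtain ⟨n, rfl⟩ : ∃ n : ℕ, a = ((n + 1 : ℕ) : ℤ) := ⟨a.toNat - 1, by lia⟩
    rw [Int.cast_natCast, pos, Int.sign_eq_one_of_pos h]
    push_cast
    ring

lemma sign_num_neg (w : ℚ) : (-w).num.sign = -w.num.sign := by
  rw [Rat.neg_num, Int.sign_neg]

/-- The effect of two partial quotients. When `w` and `a` have opposite signs, the path from `w` to
`a + w` in unit steps crosses zero once, which accounts for the term `sign w`. -/
lemma ratS4_inv_intCast_add {w : ℚ} {a : ℤ} (hw : w ≠ 0) (hw1 : |w| ≤ 1) (ha : 1 < |a|)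
    (ho : Odd w.den) : ratS4 (a + w)⁻¹ = ratS4 w⁻¹ + a - a.sign + w.num.sign := by
  -- both sides are odd in `(w, a)`, so `a` may be taken positive
  have key : ∀ (w : ℚ) (a : ℤ), w ≠ 0 → |w| ≤ 1 → 1 < a → Odd w.den →
      ratS4 (a + w)⁻¹ = ratS4 w⁻¹ + a - 1 + w.num.sign := by
    intro w a hw hw1 ha ho
    rcases hw.lt_or_gt with h | h
    · rw [Int.sign_eq_neg_one_of_neg (Rat.num_neg.2 h)]
      rcases (abs_le.1 hw1).1.eq_or_lt with h1 | h1
      · have e : (a : ℚ) + -1 = ((a - 1 : ℤ) : ℚ) := by push_cast; ring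
        rw [← h1, inv_neg, inv_one, ratS4_neg, ratS4_one, e, ratS4_inv_intCast (by lia),
          Int.sign_eq_one_of_pos (by lia)]
        ring
      · obtain ⟨n, rfl⟩ : ∃ n : ℕ, a = ((n + 1 : ℕ) : ℤ) := ⟨a.toNat - 1, by lia⟩
        have hpos : 0 < w + 1 := by linarith
        have hd : Odd (w + 1).den := by
          have := Rat.add_natCast_den w 1
          rw [Nat.cast_one] at this
          rwa [this]
        have e : (((n + 1 : ℕ) : ℤ) : ℚ) + w = (w + 1) + n := by push_cast; ring
        have hneg : w⁻¹ + 1 < 0 := by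
          have : w⁻¹ + 1 = (w + 1) / w := by field_simp; ring
          rw [this]
          exact div_neg_of_pos_of_neg hpos h
        rw [e, ratS4_inv_add_natCast hpos hd, ratS4_inv_add_one hw hpos.ne' ho,
          Int.sign_eq_neg_one_of_neg (Rat.num_neg.2 hneg)]
        push_cast
        ring
    · obtain ⟨n, rfl⟩ := Int.eq_ofNat_of_zero_le (show 0 ≤ a by lia)
      rw [Int.sign_eq_one_of_pos (Rat.num_pos.2 h), Int.cast_natCast, add_comm (n : ℚ),
        ratS4_inv_add_natCast h ho]
      ring
  rcases lt_abs.1 ha with h | h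
  · rw [key w a hw hw1 h ho, Int.sign_eq_one_of_pos (show 0 < a by lia)]
  · have := key (-w) (-a) (neg_ne_zero.2 hw) (by rwa [abs_neg]) h (by rwa [Rat.neg_den])
    rw [Int.cast_neg, ← neg_add, inv_neg, ratS4_neg, inv_neg, ratS4_neg, sign_num_neg] at this
    rw [Int.sign_eq_neg_one_of_neg (show a < 0 by lia)]
    lia

lemma sum_Icc_one_add_two (f : ℕ → ℤ) (n : ℕ) :
    ∑ k ∈ Finset.Icc 1 (n + 2), f k = f 1 + f 2 + ∑ k ∈ Finset.Icc 1 n, f (k + 2) := by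
  rw [sum_Icc_one_succ, sum_Icc_one_succ, add_assoc]

theorem IsGammaTwoExpansion.ratS4_eq {x : ℚ} {n : ℕ} {a : ℕ → ℤ} (h : IsGammaTwoExpansion x n a)
    (ho : Odd x.num) : ratS4 x = ∑ k ∈ (Finset.Icc 1 n).filter (fun k => Odd k), a k
      + ∑ k ∈ Finset.Icc 1 n, (-1) ^ k * (a k).sign := by
  refine h.rec_two (P := fun x n a => Odd x.num → ratS4 x =
    ∑ k ∈ (Finset.Icc 1 n).filter (fun k => Odd k), a k
      + ∑ k ∈ Finset.Icc 1 n, (-1) ^ k * (a k).sign) ?_ ?_ ho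
  · intro x a h1 hx _
    rw [hx, add_comm, ratS4_add_two_mul, one_div, ratS4_inv_intCast h1]
    simp [Finset.sum_filter]
    ring
  · intro x y n a h1 h2 hy ih hx hxo
    have hy1 := hy.one_le_abs h2
    have hy0 : y ≠ 0 := by
      rintro rfl
      norm_num at hy1
    have hs : y.num.sign = (a 2).sign := sign_num_eq_of_abs_sub_le h2 hy.abs_sub_le_one
    have hs' : (y⁻¹).num.sign = y.num.sign := by
      rcases hy0.lt_or_gt with h0 | h0
      · rw [Int.sign_eq_neg_one_of_neg (Rat.num_neg.2 h0),
          Int.sign_eq_neg_one_of_neg (Rat.num_neg.2 (inv_lt_zero.2 h0))]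
      · rw [Int.sign_eq_one_of_pos (Rat.num_pos.2 h0),
          Int.sign_eq_one_of_pos (Rat.num_pos.2 (inv_pos.2 h0))]
    have hzo : Odd (y⁻¹).den := by
      have h3 := odd_den_inv (odd_num_sub (a 0) hxo)
      have e : (x - 2 * a 0)⁻¹ = y⁻¹ + a 1 := by
        rw [hx]
        simp [add_comm]
      rwa [e, Rat.add_intCast_den] at h3
    have hyo : Odd y.num := by
      simpa only [inv_inv] using odd_num_inv (inv_ne_zero hy0) hzo
    rw [hx, add_comm, ratS4_add_two_mul, one_div, one_div,
      ratS4_inv_intCast_add (inv_ne_zero hy0)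
        (by rw [abs_inv]; exact inv_le_one_of_one_le₀ hy1) h1 hzo,
      inv_inv, hs', hs, ih hyo, Finset.sum_filter, Finset.sum_filter, sum_Icc_one_add_two,
      sum_Icc_one_add_two]
    simp [pow_add, Nat.odd_add, show ¬ Odd 2 by decide]
    ring

theorem theorem1 (d c : ℤ) (hc : 0 < c) (hdc : IsCoprime d c) :
    (Odd (c + d) →
      (∃ (n : ℕ) (e : ℕ → ℤ), IsThetaExpansion ((d : ℚ) / (c : ℚ)) n e) ∧
      (∀ (n m : ℕ) (e f : ℕ → ℤ), IsThetaExpansion ((d : ℚ) / (c : ℚ)) n e →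
        IsThetaExpansion ((d : ℚ) / (c : ℚ)) m f → n = m ∧ ∀ k ≤ n, e k = f k) ∧
      (∀ (n : ℕ) (e : ℕ → ℤ), IsThetaExpansion ((d : ℚ) / (c : ℚ)) n e →
        hardyS d c = -∑ k ∈ Finset.Icc 1 n, (e k).sign)) ∧
    (Odd d →
      (∃ (n : ℕ) (a : ℕ → ℤ), IsGammaTwoExpansion ((d : ℚ) / (c : ℚ)) n a) ∧
      (∀ (n : ℕ) (a : ℕ → ℤ), IsGammaTwoExpansion ((d : ℚ) / (c : ℚ)) n a →
        hardyS4 d c = ∑ k ∈ (Finset.Icc 1 n).filter (fun k => Odd k), a k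
          + ∑ k ∈ Finset.Icc 1 n, (-1) ^ k * (a k).sign)) := by
  have hnum : ((d : ℚ) / c).num = d :=
    Rat.num_div_eq_of_coprime hc (Int.isCoprime_iff_nat_coprime.1 hdc)
  have hden : (((d : ℚ) / c).den : ℤ) = c :=
    Rat.den_div_eq_of_coprime hc (Int.isCoprime_iff_nat_coprime.1 hdc)
  have hS : ratS ((d : ℚ) / c) = hardyS d c := by rw [ratS, hnum, hden]
  have hS4 : ratS4 ((d : ℚ) / c) = hardyS4 d c := by rw [ratS4, hnum, hden]
  refine ⟨fun h => ?_, fun h => ?_⟩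
  · have ho : Odd (((d : ℚ) / c).num + ((d : ℚ) / c).den) := by
      rwa [hnum, hden, add_comm]
    exact ⟨exists_isThetaExpansion ho, fun _ _ _ _ he hf => he.unique hf,
      fun n e he => by rw [← hS, he.ratS_eq ho]⟩
  · have ho : Odd ((d : ℚ) / c).num := by rwa [hnum]
    exact ⟨exists_isGammaTwoExpansion ho, fun n a ha => by rw [← hS4, ha.ratS4_eq ho]⟩
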